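/- Let $m,n\ge 0$ be integers. An $(m,n)$-colored mixed graph is a finite graph whose vertices are joined by arcs, each carrying one of $m$ arc colors, and by edges, each carrying one of $n$ edge colors, such that the underlying undirected graph is simple (no loops, and at most one arc or edge between any two vertices). A homomorphism $f:G\to H$ of $(m,n)$-colored mixed graphs is a map of the vertex sets such that whenever $xy$ is an arc (respectively edge) of color $c$ in $G$, $f(x)f(y)$ is an arc (respectively edge) of color $c$ in $H$. The chromatic number $\chi_{(m,n)}(G)$ is the least order of an $(m,n)$-colored mixed graph $H$ that admits a homomorphism $G\to H$, and $G$ is an $(m,n)$-clique if $\chi_{(m,n)}(G)=|V(G)|$. The absolute clique number $\omega_{a(m,n)}(G)$ is the maximum order of an $(m,n)$-clique that is a subgraph of $G$. A relative $(m,n)$-clique of $G$ is a set $R$ of vertices such that $f(x)\ne f(y)$ for all distinct $x,y\in R$ and every homomorphism $f$ from $G$ to any $(m,n)$-colored mixed graph; the relative clique number $\omega_{r(m,n)}(G)$ is the maximum cardinality of a relative $(m,n)$-clique of $G$. For an undirected simple graph, each of these two parameters is the maximum of its values over all $(m,n)$-colored mixed graphs with that underlying graph, and for a family of simple graphs it is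 the maximum over the members of the family. Let $\mathcal{O}$ be the family of finite outerplanar graphs, that is, of finite simple graphs that can be drawn without crossings in a closed disc of the plane with all vertices on the bounding circle (equivalently, drawn without crossings in the plane with all vertices on the boundary of the outer face). **Theorem.** For all $(m,n)\ne(0,1)$, $$\omega_{a(m,n)}(\mathcal{O})=\omega_{r(m,n)}(\mathcal{O})=3(2m+n)+1 .$$ -/

import Mathlib

universe u

/-- An `(m, n)`-colored mixed graph on the vertex set `V`: arcs carry one of `m` colors, edges carry
one of `n` colors, and the underlying undirected graph is simple, that is, there are no loops and
two vertices are joined by at most one arc or edge. (Loops of arcs are excluded by `arc_asymm`.) -/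
structure ColoredMixedGraph (m n : ℕ) (V : Type*) where
  /-- `arc c x y`: there is an arc of color `c` from `x` to `y`. -/
  arc : Fin m → V → V → Prop
  /-- `edge c x y`: there is an edge of color `c` between `x` and `y`. -/
  edge : Fin n → V → V → Prop
  edge_symm : ∀ c x y, edge c x y → edge c y x
  edge_irrefl : ∀ c x, ¬ edge c x x
  arc_asymm : ∀ c d x y, arc c x y → ¬ arc d y x
  arc_color_unique : ∀ c d x y, arc c x y → arc d x y → c = d
  edge_color_unique : ∀ c d x y, edge c x y → edge d x y → c = d
  not_arc_and_edge : ∀ c d x y, arc c x y → ¬ edge d x y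

namespace ColoredMixedGraph

variable {m n : ℕ} {V W : Type*}

/-- The underlying undirected simple graph. -/
def underlying (G : ColoredMixedGraph m n V) : SimpleGraph V where
  Adj x y := (∃ c, G.arc c x y ∨ G.arc c y x) ∨ ∃ c, G.edge c x y
  symm := ⟨by
    rintro x y (⟨c, h | h⟩ | ⟨c, h⟩)
    · exact Or.inl ⟨c, Or.inr h⟩
    · exact Or.inl ⟨c, Or.inl h⟩
    · exact Or.inr ⟨c, G.edge_symm c x y h⟩⟩
  loopless := ⟨by
    rintro x (⟨c, h | h⟩ | ⟨c, h⟩)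
    · exact G.arc_asymm c c x x h h
    · exact G.arc_asymm c c x x h h
    · exact G.edge_irrefl c x h⟩

/-- `f` is a colored homomorphism from `G` to `H`. -/
def IsHom (G : ColoredMixedGraph m n V) (H : ColoredMixedGraph m n W) (f : V → W) : Prop :=
  (∀ c x y, G.arc c x y → H.arc c (f x) (f y)) ∧ (∀ c x y, G.edge c x y → H.edge c (f x) (f y))

/-- The `(m, n)`-colored mixed chromatic number of a finite colored mixed graph: the least order of
a colored mixed graph to which `G` admits a homomorphism. -/
noncomputable def chromaticNumber (G : ColoredMixedGraph m n V) : ℕ :=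
  sInf {k : ℕ | ∃ (H : ColoredMixedGraph m n (Fin k)) (f : V → Fin k), G.IsHom H f}

/-- A finite colored mixed graph is an `(m, n)`-clique if its chromatic number is its order. -/
def IsClique (G : ColoredMixedGraph m n V) : Prop :=
  G.chromaticNumber = Nat.card V

/-- `H`, a colored mixed graph on a set `S` of vertices of `G`, is a (not necessarily induced)
subgraph of `G`. -/
def IsSubgraph {S : Set V} (H : ColoredMixedGraph m n S) (G : ColoredMixedGraph m n V) : Prop :=
  H.IsHom G Subtype.val

/-- The absolute clique number of `G`: the maximum order of an `(m, n)`-clique which is a subgraph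
of `G`. -/
noncomputable def absCliqueNumber (G : ColoredMixedGraph m n V) : ℕ∞ :=
  ⨆ (S : Set V) (H : ColoredMixedGraph m n S) (_ : H.IsSubgraph G) (_ : H.IsClique), S.encard

/-- `R` is a relative `(m, n)`-clique of `G`: no homomorphism from `G` to any (finite) colored mixed
graph identifies two distinct vertices of `R`. -/
def IsRelClique {V : Type u} (G : ColoredMixedGraph m n V) (R : Set V) : Prop :=
  ∀ x ∈ R, ∀ y ∈ R, x ≠ y →
    ∀ (W : Type u) [Finite W] (H : ColoredMixedGraph m n W) (f : V → W), G.IsHom H f → f x ≠ f y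

/-- The relative clique number of `G`: the maximum cardinality of a relative `(m, n)`-clique. -/
noncomputable def relCliqueNumber {V : Type u} (G : ColoredMixedGraph m n V) : ℕ∞ :=
  ⨆ (R : Set V) (_ : G.IsRelClique R), R.encard

end ColoredMixedGraph

/-- The absolute clique number of a simple graph: the maximum over all `(m, n)`-colored mixed graphs
with this underlying graph. -/
noncomputable def SimpleGraph.absCliqueNumber (m n : ℕ) {V : Type u} (G : SimpleGraph V) : ℕ∞ :=
  ⨆ (C : ColoredMixedGraph m n V) (_ : C.underlying = G), C.absCliqueNumber

/-- The relative clique number of a simple graph: the maximum over all `(m, n)`-colored mixed graphs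
with this underlying graph. -/
noncomputable def SimpleGraph.relCliqueNumber (m n : ℕ) {V : Type u} (G : SimpleGraph V) : ℕ∞ :=
  ⨆ (C : ColoredMixedGraph m n V) (_ : C.underlying = G), C.relCliqueNumber

/-- The absolute clique number of a family of finite simple graphs: the maximum over its members.
(A supremum in `ℕ∞` that is a natural number and nonzero is attained.) -/
noncomputable def familyAbsCliqueNumber (m n : ℕ)
    (F : ∀ {V : Type u}, SimpleGraph V → Prop) : ℕ∞ :=
  ⨆ (V : Type u) (_ : Finite V) (G : SimpleGraph V) (_ : F G), G.absCliqueNumber m n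

/-- The relative clique number of a family of finite simple graphs: the maximum over its members. -/
noncomputable def familyRelCliqueNumber (m n : ℕ)
    (F : ∀ {V : Type u}, SimpleGraph V → Prop) : ℕ∞ :=
  ⨆ (V : Type u) (_ : Finite V) (G : SimpleGraph V) (_ : F G), G.relCliqueNumber m n

/-- A crossing-free drawing of `G` in the closed unit disc of the plane with all vertices on the
bounding circle, and hence on the outer face. The edges are drawn as simple arcs; an arc contains no
vertices besides its ends, and two arcs meet only in the position of a common end. -/
structure OuterplanarDrawing {V : Type u} (G : SimpleGraph V) where
  /-- the point representing a vertex -/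
  pos : V → ℂ
  /-- the set of points of the arc representing an edge -/
  arc : G.edgeSet → Set ℂ
  pos_injective : Function.Injective pos
  pos_mem_circle : ∀ v, pos v ∈ Metric.sphere (0 : ℂ) 1
  arc_subset_disc : ∀ e, arc e ⊆ Metric.closedBall (0 : ℂ) 1
  isArc : ∀ (v w : V) (h : G.Adj v w),
    ∃ γ : Path (pos v) (pos w), Function.Injective γ ∧ Set.range γ = arc ⟨s(v, w), h⟩
  end_of_pos_mem_arc : ∀ (v : V) (e : G.edgeSet), pos v ∈ arc e → v ∈ e.1
  arc_inter_arc : ∀ e f : G.edgeSet, e ≠ f → arc e ∩ arc f ⊆ pos '' {v | v ∈ e.1 ∧ v ∈ f.1}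

/-- A graph is outerplanar if it has a crossing-free drawing with all vertices on the outer face,
the outer face being bounded by a circle which contains the vertices. -/
def IsOuterplanar {V : Type u} (G : SimpleGraph V) : Prop :=
  Nonempty (OuterplanarDrawing G)

/-- Along a curve that stays in a rotated slit plane, any continuous branch of the logarithm changes
by the same amount as the principal branch. -/
theorem sub_eq_log_sub_log_of_exp_eq_mul {h g : ℝ → ℂ} (hh : Continuous h) (hg : Continuous g)
    (hslit : ∀ s, g s ∈ Complex.slitPlane) {u : ℂ} (hu : ∀ s, Complex.exp (h s) = u * g s)
    (s t : ℝ) : h t - h s = Complex.log (g t) - Complex.log (g s) := by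
  have hcont : Continuous fun s => h s - Complex.log (g s) := hh.sub (hg.clog hslit)
  have key := Complex.isCoveringMap_exp.const_of_comp hcont (fun a b => by
    have : ∀ a, Complex.exp (h a - Complex.log (g a)) = u := fun a => by
      rw [Complex.exp_sub, hu, Complex.exp_log (Complex.slitPlane_ne_zero (hslit a)),
        mul_div_assoc, div_self (Complex.slitPlane_ne_zero (hslit a)), mul_one]
    exact Subtype.ext ((this a).trans (this b).symm)) s t
  linear_combination -key

theorem re_one_sub_div_pos {b z : ℂ} (hb : ‖b‖ = 1) (hz : ‖z‖ ≤ 1) (hne : z ≠ b) :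
    0 < (1 - z / b).re := by
  have hb0 : b ≠ 0 := norm_ne_zero_iff.1 (by rw [hb]; exact one_ne_zero)
  have hw : ‖z / b‖ ≤ 1 := by rwa [norm_div, hb, div_one]
  have hw1 : z / b ≠ 1 := fun h => hne ((div_eq_one_iff_eq hb0).1 h)
  generalize z / b = w at hw hw1
  rw [Complex.sub_re, Complex.one_re, sub_pos]
  refine lt_of_le_of_ne ((Complex.re_le_norm w).trans hw) fun h => hw1 ?_
  have h2 : w.re * w.re + w.im * w.im ≤ 1 := by
    rw [← Complex.normSq_apply, Complex.normSq_eq_norm_sq]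
    exact pow_le_one₀ (norm_nonneg _) hw
  have : w.im = 0 := by
    rw [h] at h2
    exact mul_self_eq_zero.1 (le_antisymm (by linarith) (mul_self_nonneg _))
  exact Complex.ext h this

/-- The variation of a continuous logarithm of `z - b` along a curve in the closed disc that avoids
a point `b` of the bounding circle. -/
theorem log_variation_sub_point {h γ : ℝ → ℂ} (hh : Continuous h) (hγ : Continuous γ) {b : ℂ}
    (hb : ‖b‖ = 1) (hγ1 : ∀ s, ‖γ s‖ ≤ 1) (hne : ∀ s, γ s ≠ b) {u : ℂ}
    (hu : ∀ s, Complex.exp (h s) = u * (γ s - b)) (s t : ℝ) :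
    (h t - h s).im = (1 - γ t / b).arg - (1 - γ s / b).arg := by
  have hb0 : b ≠ 0 := norm_ne_zero_iff.1 (by rw [hb]; exact one_ne_zero)
  rw [sub_eq_log_sub_log_of_exp_eq_mul (g := fun s => 1 - γ s / b) (u := -(u * b)) hh (by fun_prop)
    (fun s => Or.inl (re_one_sub_div_pos hb (hγ1 s) (hne s))) (fun s => ?_) s t, Complex.sub_im,
    Complex.log_im, Complex.log_im]
  rw [hu]; field_simp; ring

theorem arg_one_sub_exp_mul_I {θ : ℝ} (h0 : 0 < θ) (h2 : θ < 2 * Real.pi) :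
    (1 - Complex.exp (θ * Complex.I)).arg = (θ - Real.pi) / 2 := by
  obtain ⟨x, rfl⟩ : ∃ x, θ = 2 * x := ⟨θ / 2, by ring⟩
  have hs : 0 < 2 * Real.sin x :=
    mul_pos two_pos (Real.sin_pos_of_pos_of_lt_pi (by linarith) (by linarith))
  have e : (2 * x - Real.pi) / 2 = x - Real.pi / 2 := by ring
  have : 1 - Complex.exp ((2 * x : ℝ) * Complex.I) = ((2 * Real.sin x : ℝ) : ℂ) *
      (Complex.cos ((x - Real.pi / 2 : ℝ) : ℂ) +
        Complex.sin ((x - Real.pi / 2 : ℝ) : ℂ) * Complex.I) := by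
    rw [Complex.exp_mul_I, ← Complex.ofReal_cos, ← Complex.ofReal_sin, ← Complex.ofReal_cos,
      ← Complex.ofReal_sin, Real.cos_sub_pi_div_two, Real.sin_sub_pi_div_two, Real.cos_two_mul,
      Real.sin_two_mul]
    have := Real.sin_sq_add_cos_sq x
    apply Complex.ext <;> simp only [Complex.sub_re, Complex.add_re, Complex.one_re, Complex.mul_re,
      Complex.ofReal_re, Complex.ofReal_im, Complex.I_re, Complex.I_im, Complex.sub_im,
      Complex.add_im, Complex.one_im, Complex.mul_im] <;> linarith
  rw [this, e, Complex.arg_mul_cos_add_sin_mul_I hs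
    ⟨by linarith [Real.pi_pos], by linarith [Real.pi_pos]⟩]

theorem arg_one_sub_div_of_lt {α β : ℝ} (h : α < β) (h2 : β < α + 2 * Real.pi) :
    (1 - Complex.exp (β * Complex.I) / Complex.exp (α * Complex.I)).arg = (β - α - Real.pi) / 2 := by
  rw [← Complex.exp_sub, ← sub_mul, ← Complex.ofReal_sub,
    arg_one_sub_exp_mul_I (by linarith) (by linarith)]

theorem arg_one_sub_div_of_gt {α β : ℝ} (h : α < β) (h2 : β < α + 2 * Real.pi) :
    (1 - Complex.exp (α * Complex.I) / Complex.exp (β * Complex.I)).arg =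
      -((β - α - Real.pi) / 2) := by
  have : Complex.exp (α * Complex.I) / Complex.exp (β * Complex.I) =
      Complex.exp ((α - β + 2 * Real.pi : ℝ) * Complex.I) := by
    rw [← Complex.exp_sub, ← sub_mul, ← Complex.ofReal_sub, Complex.ofReal_add, add_mul,
      Complex.exp_add]
    simp [Complex.exp_two_pi_mul_I]
  rw [this, arg_one_sub_exp_mul_I (by linarith) (by linarith)]
  ring

/-- Two curves in the closed unit disc whose end points interlace on the bounding circle meet. -/
theorem exists_mem_range_of_interlacing {α β γ δ : ℝ} (hαβ : α < β) (hβγ : β < γ) (hγδ : γ < δ)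
    (hδα : δ < α + 2 * Real.pi) {a b c d : ℂ} (ha : Complex.exp (α * Complex.I) = a)
    (hb : Complex.exp (β * Complex.I) = b) (hc : Complex.exp (γ * Complex.I) = c)
    (hd : Complex.exp (δ * Complex.I) = d) (p : Path a c) (q : Path b d)
    (hp : Set.range p ⊆ Metric.closedBall 0 1) (hq : Set.range q ⊆ Metric.closedBall 0 1) :
    (Set.range p ∩ Set.range q).Nonempty := by
  by_contra hempty
  have hp1 : ∀ s, ‖p.extend s‖ ≤ 1 := fun s => by
    simpa using hp (p.extend_range ▸ Set.mem_range_self s)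
  have hq1 : ∀ s, ‖q.extend s‖ ≤ 1 := fun s => by
    simpa using hq (q.extend_range ▸ Set.mem_range_self s)
  have hne : ∀ s t, p.extend s ≠ q.extend t := fun s t h => hempty
    ⟨p.extend s, p.extend_range ▸ Set.mem_range_self s, h ▸ q.extend_range ▸ Set.mem_range_self t⟩
  have hpc := p.continuous_extend
  have hqc := q.continuous_extend
  obtain ⟨L, ⟨-, hL⟩, -⟩ := Complex.isCoveringMapOn_exp.existsUnique_continuousMap_lifts
    (⟨fun x : ℝ × ℝ => p.extend x.1 - q.extend x.2, by fun_prop⟩ : C(ℝ × ℝ, ℂ)) (a₀ := (0, 0))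
    (Complex.exp_log (sub_ne_zero.2 (hne 0 0))) (fun x => sub_ne_zero.2 (hne x.1 x.2))
  have hL' : ∀ s t, Complex.exp (L (s, t)) = p.extend s - q.extend t := fun s t => congrFun hL (s, t)
  have n1 : ∀ θ : ℝ, ‖Complex.exp (θ * Complex.I)‖ = 1 := Complex.norm_exp_ofReal_mul_I
  have c1 : ∀ t : ℝ, Continuous fun s => L (s, t) := fun t => by fun_prop
  have c2 : ∀ s : ℝ, Continuous fun t => L (s, t) := fun s => by fun_prop
  have bottom := log_variation_sub_point (c1 0) hpc (hb ▸ n1 β) hp1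
    (fun s => by simpa using hne s 0) (u := 1) (fun s => by simpa using hL' s 0) 0 1
  have top := log_variation_sub_point (c1 1) hpc (hd ▸ n1 δ) hp1
    (fun s => by simpa using hne s 1) (u := 1) (fun s => by simpa using hL' s 1) 0 1
  have left := log_variation_sub_point (c2 0) hqc (ha ▸ n1 α) hq1
    (fun s => by simpa using (hne 0 s).symm) (u := -1) (fun s => by simpa using hL' 0 s) 0 1
  have right := log_variation_sub_point (c2 1) hqc (hc ▸ n1 γ) hq1
    (fun s => by simpa using (hne 1 s).symm) (u := -1) (fun s => by simpa using hL' 1 s) 0 1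
  subst ha hb hc hd
  simp only [Path.extend_zero, Path.extend_one, Complex.sub_im] at bottom top left right
  rw [arg_one_sub_div_of_lt hβγ (by linarith), arg_one_sub_div_of_gt hαβ (by linarith)] at bottom
  rw [arg_one_sub_div_of_gt hγδ (by linarith), arg_one_sub_div_of_gt (hαβ.trans (hβγ.trans hγδ))
    (by linarith)] at top
  rw [arg_one_sub_div_of_lt hαβ (by linarith), arg_one_sub_div_of_lt (hαβ.trans (hβγ.trans hγδ))
    (by linarith)] at left
  rw [arg_one_sub_div_of_lt hγδ (by linarith), arg_one_sub_div_of_gt hβγ (by linarith)] at right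
  linarith [Real.pi_pos]

/-- `f` puts the vertices of `G` in a linear order such that no two edges of `G`, drawn as chords of
a circle, cross. -/
structure SimpleGraph.IsNoncrossing {V : Type*} (G : SimpleGraph V) (f : V → ℝ) : Prop where
  injective : Function.Injective f
  not_cross : ∀ {a b c d}, f a < f b → f b < f c → f c < f d → G.Adj a c → ¬ G.Adj b d

theorem OuterplanarDrawing.isNoncrossing {V : Type u} {G : SimpleGraph V}
    (D : OuterplanarDrawing G) : G.IsNoncrossing fun v => (D.pos v).arg := by
  have hpos : ∀ v, Complex.exp ((D.pos v).arg * Complex.I) = D.pos v := fun v => by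
    have h := Complex.norm_mul_exp_arg_mul_I (D.pos v)
    rwa [mem_sphere_zero_iff_norm.1 (D.pos_mem_circle v), Complex.ofReal_one, one_mul] at h
  refine ⟨fun v w h => D.pos_injective ?_, fun {a b c d} hab hbc hcd hac hbd => ?_⟩
  · rw [← hpos v, ← hpos w]; exact congrArg (fun θ : ℝ => Complex.exp (θ * Complex.I)) h
  obtain ⟨p, -, hp⟩ := D.isArc a c hac
  obtain ⟨q, -, hq⟩ := D.isArc b d hbd
  obtain ⟨z, hzp, hzq⟩ := exists_mem_range_of_interlacing hab hbc hcd
    (by linarith [Complex.neg_pi_lt_arg (D.pos a), Complex.arg_le_pi (D.pos d)])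
    (hpos a) (hpos b) (hpos c) (hpos d) p q (hp ▸ D.arc_subset_disc _) (hq ▸ D.arc_subset_disc _)
  have hne : ∀ {x y}, (D.pos x).arg < (D.pos y).arg → x ≠ y := fun h e => h.ne (by rw [e])
  have h1 := hne hab
  have h2 := hne hbc
  have h3 := hne hcd
  have h4 := hne (hab.trans (hbc.trans hcd))
  obtain ⟨v, ⟨hv1, hv2⟩, -⟩ := D.arc_inter_arc ⟨s(a, c), hac⟩ ⟨s(b, d), hbd⟩
    (fun h => by simpa [h1, h4] using congrArg Subtype.val h) ⟨hp ▸ hzp, hq ▸ hzq⟩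
  simp only [Sym2.mem_iff] at hv1 hv2
  grind

/-- The rational parametrization of the unit circle. -/
noncomputable def circlePoint (t : ℝ) : ℂ := ⟨(1 - t ^ 2) / (1 + t ^ 2), 2 * t / (1 + t ^ 2)⟩

/-- The affine form which vanishes on the line through `circlePoint a` and `circlePoint b`. -/
def chordForm (a b : ℝ) (z : ℂ) : ℝ := (1 - a * b) * z.re + (a + b) * z.im - (1 + a * b)

theorem chordForm_circlePoint (a b t : ℝ) :
    chordForm a b (circlePoint t) = -2 * ((t - a) * (t - b)) / (1 + t ^ 2) := by
  have : (1 + t ^ 2) ≠ 0 := by positivity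
  simp only [chordForm, circlePoint]
  field_simp
  ring

theorem norm_circlePoint (t : ℝ) : ‖circlePoint t‖ = 1 := by
  have h : (1 + t ^ 2) ≠ 0 := by positivity
  rw [← sq_eq_sq₀ (norm_nonneg _) zero_le_one, ← Complex.normSq_eq_norm_sq, Complex.normSq_apply]
  simp only [circlePoint]
  field_simp
  ring

theorem chordForm_circlePoint_eq_zero {a b t : ℝ} :
    chordForm a b (circlePoint t) = 0 ↔ t = a ∨ t = b := by
  have : (1 + t ^ 2) ≠ 0 := by positivity
  rw [chordForm_circlePoint]
  simp [this, sub_eq_zero]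

theorem circlePoint_injective : Function.Injective circlePoint := fun a b h => by
  have : chordForm b b (circlePoint a) = 0 := h ▸ chordForm_circlePoint_eq_zero.2 (Or.inl rfl)
  simpa using chordForm_circlePoint_eq_zero.1 this

theorem chordForm_combination (a b : ℝ) (z w : ℂ) {s r : ℝ} (h : s + r = 1) :
    chordForm a b (s • z + r • w) = s * chordForm a b z + r * chordForm a b w := by
  simp only [chordForm, Complex.add_re, Complex.add_im, Complex.smul_re, Complex.smul_im,
    smul_eq_mul]
  linear_combination (1 + a * b) * h

theorem chordForm_eq_zero_of_mem_segment {a b : ℝ} {z : ℂ}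
    (h : z ∈ segment ℝ (circlePoint a) (circlePoint b)) : chordForm a b z = 0 := by
  obtain ⟨s, r, -, -, hsr, rfl⟩ := h
  rw [chordForm_combination _ _ _ _ hsr, chordForm_circlePoint_eq_zero.2 (Or.inl rfl),
    chordForm_circlePoint_eq_zero.2 (Or.inr rfl)]
  simp

/-- Two chords of a circle that do not cross meet in a common end point at most. -/
theorem eq_endpoint_of_mem_chords {a b c d : ℝ}
    (hsep : 0 ≤ ((c - a) * (c - b)) * ((d - a) * (d - b)))
    (hne : ¬((c = a ∨ c = b) ∧ (d = a ∨ d = b))) {z : ℂ}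
    (h1 : z ∈ segment ℝ (circlePoint a) (circlePoint b))
    (h2 : z ∈ segment ℝ (circlePoint c) (circlePoint d)) :
    (z = circlePoint c ∧ (c = a ∨ c = b)) ∨ (z = circlePoint d ∧ (d = a ∨ d = b)) := by
  have h0 := chordForm_eq_zero_of_mem_segment h1
  obtain ⟨s, r, hs, hr, hsr, rfl⟩ := h2
  rw [chordForm_combination _ _ _ _ hsr] at h0
  have hcd : 0 ≤ chordForm a b (circlePoint c) * chordForm a b (circlePoint d) := by
    rw [chordForm_circlePoint, chordForm_circlePoint]
    have : 0 ≤ 4 * (((c - a) * (c - b)) * ((d - a) * (d - b))) / ((1 + c ^ 2) * (1 + d ^ 2)) := by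
      positivity
    refine this.trans_eq ?_
    rw [div_mul_div_comm]; ring
  have hc : s * chordForm a b (circlePoint c) = 0 := by
    have := mul_nonneg (mul_nonneg hs hr) hcd
    refine pow_eq_zero_iff two_ne_zero |>.1 (le_antisymm ?_ (sq_nonneg _))
    linear_combination s * chordForm a b (circlePoint c) * h0 + this
  have hd : r * chordForm a b (circlePoint d) = 0 := by linarith
  rw [mul_eq_zero, chordForm_circlePoint_eq_zero] at hc hd
  rcases hc with rfl | hc
  · have : r = 1 := by linarith
    subst this
    exact Or.inr ⟨by simp, hd.resolve_left one_ne_zero⟩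
  · rcases hd with rfl | hd
    · have : s = 1 := by linarith
      subst this
      exact Or.inl ⟨by simp, hc⟩
    · exact absurd ⟨hc, hd⟩ hne

namespace SimpleGraph.IsNoncrossing

variable {V : Type u} {G : SimpleGraph V} {f : V → ℝ}

theorem separation_nonneg (hf : G.IsNoncrossing f) {a b c d : V} (hab : G.Adj a b)
    (hcd : G.Adj c d) :
    0 ≤ ((f c - f a) * (f c - f b)) * ((f d - f a) * (f d - f b)) := by
  wlog h1 : f a < f b generalizing a b
  · have := this hab.symm ((not_lt.1 h1).lt_of_ne fun h => hab.ne (hf.injective h.symm))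
    linarith
  wlog h2 : f c < f d generalizing c d
  · have := this hcd.symm ((not_lt.1 h2).lt_of_ne fun h => hcd.ne (hf.injective h.symm))
    linarith
  by_contra! hneg
  rcases le_or_gt (f c) (f a) with hca | hca
  · have e1 : 0 ≤ (f c - f a) * (f c - f b) :=
      mul_nonneg_of_nonpos_of_nonpos (by linarith) (by linarith)
    rcases le_or_gt (f d) (f a) with hda | hda
    · exact hneg.not_ge (mul_nonneg e1 (mul_nonneg_of_nonpos_of_nonpos (by linarith) (by linarith)))
    rcases le_or_gt (f b) (f d) with hdb | hdb
    · exact hneg.not_ge (mul_nonneg e1 (mul_nonneg (by linarith) (by linarith)))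
    rcases hca.lt_or_eq with hca | hca
    · exact hf.not_cross hca hda hdb hcd hab
    · simp [hca] at hneg
  · rcases le_or_gt (f b) (f c) with hcb | hcb
    · exact hneg.not_ge (mul_nonneg (mul_nonneg (by linarith) (by linarith))
        (mul_nonneg (by linarith) (by linarith)))
    have e1 : (f c - f a) * (f c - f b) ≤ 0 :=
      mul_nonpos_of_nonneg_of_nonpos (by linarith) (by linarith)
    rcases le_or_gt (f d) (f b) with hdb | hdb
    · exact hneg.not_ge (mul_nonneg_of_nonpos_of_nonpos e1
        (mul_nonpos_of_nonneg_of_nonpos (by linarith) (by linarith)))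
    · exact hf.not_cross hca hcb hdb hab hcd

/-- A graph without crossing chords is outerplanar: its edges can be drawn as chords. -/
theorem isOuterplanar (hf : G.IsNoncrossing f) : IsOuterplanar G := by
  have hinj : Function.Injective fun v => circlePoint (f v) :=
    circlePoint_injective.comp hf.injective
  have harc : ∀ v w, convexHull ℝ ((fun v => circlePoint (f v)) '' {x | x ∈ s(v, w)}) =
      segment ℝ (circlePoint (f v)) (circlePoint (f w)) := fun v w => by
    rw [← convexHull_pair, ← Set.image_pair (fun v => circlePoint (f v))]
    congr 2
    ext x
    simp
  refine ⟨⟨fun v => circlePoint (f v),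
    fun e => convexHull ℝ ((fun v => circlePoint (f v)) '' {x | x ∈ e.1}), hinj,
    fun v => by simp [norm_circlePoint], fun e => ?_, fun v w h => ?_, ?_, ?_⟩⟩
  · refine convexHull_min ?_ (convex_closedBall 0 1)
    rintro _ ⟨x, -, rfl⟩
    simp [norm_circlePoint]
  · refine ⟨⟨⟨fun t => AffineMap.lineMap (circlePoint (f v)) (circlePoint (f w)) (t : ℝ),
      by fun_prop⟩, by simp, by simp⟩, ?_, ?_⟩
    · exact (AffineMap.lineMap_injective ℝ (hinj.ne h.ne)).comp Subtype.val_injective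
    · rw [harc, segment_eq_image_lineMap]
      ext z
      simp
  · rintro v ⟨e, he⟩ hv
    induction e with | _ a b => ?_
    simp only [harc] at hv
    have := chordForm_circlePoint_eq_zero.1 (chordForm_eq_zero_of_mem_segment hv)
    rw [hf.injective.eq_iff, hf.injective.eq_iff] at this
    simpa using this
  · rintro ⟨e, he⟩ ⟨e', he'⟩ hne z ⟨hz, hz'⟩
    induction e with | _ a b => ?_
    induction e' with | _ c d => ?_
    simp only [harc] at hz hz'
    have h1 : a ≠ b := G.ne_of_adj he
    have h2 : c ≠ d := G.ne_of_adj he'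
    have hne' : s(a, b) ≠ s(c, d) := fun h => hne (Subtype.ext h)
    rcases eq_endpoint_of_mem_chords (hf.separation_nonneg he he') (by
      rw [hf.injective.eq_iff, hf.injective.eq_iff, hf.injective.eq_iff, hf.injective.eq_iff]
      rw [Ne, Sym2.eq_iff] at hne'
      grind) hz hz' with ⟨rfl, h⟩ | ⟨rfl, h⟩ <;>
    rw [hf.injective.eq_iff, hf.injective.eq_iff] at h
    · exact ⟨c, ⟨by simpa using h, by simp⟩, rfl⟩
    · exact ⟨d, ⟨by simpa using h, by simp⟩, rfl⟩

end SimpleGraph.IsNoncrossing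

theorem exists_strictMono_comp_of_le_ncard {V : Type*} {f : V → ℝ} (hf : Function.Injective f)
    {S : Set V} {k : ℕ} (hk : k ≤ S.ncard) (hk0 : k ≠ 0) :
    ∃ e : Fin k → V, (∀ i, e i ∈ S) ∧ StrictMono (f ∘ e) := by
  classical
  have hfin : S.Finite := Set.finite_of_ncard_pos (by omega)
  have hcard : k ≤ (hfin.toFinset.image f).card := by
    rwa [Finset.card_image_of_injective _ hf, ← Set.ncard_eq_toFinset_card S hfin]
  have hmem := fun i => Finset.orderEmbOfCardLe_mem _ hcard i
  simp only [Finset.mem_image, Set.Finite.mem_toFinset] at hmem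
  choose e he hfe using hmem
  exact ⟨e, he, fun i j hij => by
    simpa only [Function.comp_apply, hfe] using (Finset.orderEmbOfCardLe _ hcard).strictMono hij⟩

namespace SimpleGraph

variable {V : Type*} {G : SimpleGraph V} {f : V → ℝ}

/-- Any two vertices of `R` are adjacent or have a common neighbor. -/
def IsNear (G : SimpleGraph V) (R : Set V) : Prop :=
  ∀ x ∈ R, ∀ y ∈ R, x ≠ y → G.Adj x y ∨ ∃ c, G.Adj x c ∧ G.Adj y c

namespace IsNoncrossing

theorem rotate (hf : G.IsNoncrossing f) {K : ℝ} (hK : ∀ x y, f x < f y + K) (t : ℝ) :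
    G.IsNoncrossing fun x => if f x < t then f x + K else f x := by
  refine ⟨fun x y hxy => hf.injective ?_, fun {a b c d} hab hbc hcd hac hbd => ?_⟩
  · have := hK x y
    have := hK y x
    split_ifs at hxy <;> linarith
  · have := hK a d
    have := hK b a
    have := hK c a
    have := hK d a
    have := hK c b
    have := hK d b
    have := hK d c
    have := @hf.not_cross a b c d
    have := @hf.not_cross b c d a
    have := @hf.not_cross c d a b
    have := @hf.not_cross d a b c
    have := hac.symm
    have := hbd.symm
    split_ifs at hab hbc hcd <;> first | linarith | grind

theorem exists_rotate_bound [Finite V] (f : V → ℝ) : ∃ K, ∀ x y, f x < f y + K := by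
  obtain ⟨M, hM⟩ := (Set.finite_range f).bddAbove
  obtain ⟨N, hN⟩ := (Set.finite_range f).bddBelow
  refine ⟨M - N + 1, fun x y => ?_⟩
  have := hM (Set.mem_range_self x)
  have := hN (Set.mem_range_self y)
  linarith

theorem exists_min [Finite V] (hf : G.IsNoncrossing f) (v : V) :
    ∃ g, G.IsNoncrossing g ∧ ∀ x, x ≠ v → g v < g x := by
  obtain ⟨K, hK⟩ := exists_rotate_bound f
  refine ⟨_, hf.rotate hK (f v), fun x hx => ?_⟩
  have := hK v x
  have : f x ≠ f v := hf.injective.ne hx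
  split_ifs <;> grind

/-- An edge separates the vertices strictly between its ends from the other vertices. -/
theorem confined (hf : G.IsNoncrossing f) {p q x y : V} (hpq : G.Adj p q) (hxy : G.Adj x y)
    (hpx : f p < f x) (hxq : f x < f q) : f p ≤ f y ∧ f y ≤ f q := by
  refine ⟨not_lt.1 fun h => ?_, not_lt.1 fun h => ?_⟩
  · exact hf.not_cross h hpx hxq hxy.symm hpq
  · exact hf.not_cross hpx hxq h hpq hxy

theorem near_across (hf : G.IsNoncrossing f) {R : Set V} (hR : G.IsNear R) {p q x y : V}
    (hpq : G.Adj p q) (hx : x ∈ R) (hy : y ∈ R) (hpx : f p < f x) (hxq : f x < f q)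
    (hy' : f y < f p ∨ f q < f y) : (G.Adj x p ∧ G.Adj y p) ∨ (G.Adj x q ∧ G.Adj y q) := by
  rcases hR x hx y hy (by rintro rfl; rcases hy' with h | h <;> linarith) with h | ⟨c, hxc, hyc⟩
  · have := hf.confined hpq h hpx hxq
    rcases hy' with h | h <;> linarith
  · obtain ⟨h1, h2⟩ := hf.confined hpq hxc hpx hxq
    rcases h1.eq_or_lt with h1 | h1
    · obtain rfl := hf.injective h1
      exact Or.inl ⟨hxc, hyc⟩
    rcases h2.eq_or_lt with h2 | h2
    · obtain rfl := hf.injective h2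
      exact Or.inr ⟨hxc, hyc⟩
    · have := hf.confined hpq hyc.symm h1 h2
      rcases hy' with h | h <;> linarith

/-- Two vertices on the same side of an edge are not both adjacent to both of its ends. -/
theorem not_both_adj (hf : G.IsNoncrossing f) {p q x y : V} (hpx : f p < f x) (hxy : f x < f y)
    (hyq : f y < f q) (h1 : G.Adj y p) (h2 : G.Adj x q) : False :=
  hf.not_cross hpx hxy hyq h1.symm h2

theorem exists_dominating_of_adj (hf : G.IsNoncrossing f) {R : Set V} (hR : G.IsNear R)
    {p q : V} (hmin : ∀ x, x ≠ p → f p < f x) (hpq : G.Adj p q)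
    {a₁ a₂ b₁ b₂ : V} (ha₁ : a₁ ∈ R) (ha₂ : a₂ ∈ R) (hb₁ : b₁ ∈ R) (hb₂ : b₂ ∈ R)
    (h₁ : f p < f a₁) (h₂ : f a₁ < f a₂) (h₃ : f a₂ < f q) (h₄ : f q < f b₁) (h₅ : f b₁ < f b₂) :
    ∃ v, ∀ x ∈ R, x ≠ v → G.Adj v x := by
  by_contra! hcon
  have across := fun a b (ha : a ∈ R) (hb : b ∈ R) h h' h'' =>
    hf.near_across hR hpq ha hb h h' (Or.inr h'')
  have hA : ¬(G.Adj a₂ p ∧ G.Adj a₁ q) := fun h => hf.not_both_adj h₁ h₂ h₃ h.1 h.2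
  have hB : ¬(G.Adj b₁ p ∧ G.Adj b₂ q) := fun h =>
    hf.not_cross (h₁.trans (h₂.trans h₃)) h₄ h₅ h.1.symm h.2.symm
  have side : ∀ x ∈ R, x ≠ p → x ≠ q → (f p < f x ∧ f x < f q) ∨ f q < f x :=
    fun x _ hp hq => by
      have := hf.injective.ne hq
      have := hmin x hp
      grind
  have key : ∀ x ∈ R, x ≠ p → ¬G.Adj p x → ∀ y ∈ R, y ≠ q → G.Adj q y := by
    intro x hx hxp hpx y hy hyq
    have hxq : x ≠ q := by rintro rfl; exact hpx hpq
    by_cases hyp : y = p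
    · exact hyp ▸ hpq.symm
    have hpx' : ¬G.Adj x p := fun h => hpx h.symm
    apply SimpleGraph.Adj.symm
    rcases side x hx hxp hxq with ⟨hx1, hx2⟩ | hx1
    · have hBq : ∀ b ∈ R, f q < f b → G.Adj b q := fun b hb h => by grind
      rcases side y hy hyp hyq with ⟨hy1, hy2⟩ | hy1
      · have := across y b₁ hy hb₁ hy1 hy2 h₄
        have := across y b₂ hy hb₂ hy1 hy2 (h₄.trans h₅)
        grind
      · exact hBq y hy hy1
    · have hAq : ∀ a ∈ R, f p < f a → f a < f q → G.Adj a q := fun a ha h h' => by grind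
      rcases side y hy hyp hyq with ⟨hy1, hy2⟩ | hy1
      · exact hAq y hy hy1 hy2
      · have := across a₁ y ha₁ hy h₁ (h₂.trans h₃) hy1
        have := across a₂ y ha₂ hy (h₁.trans h₂) h₃ hy1
        have := hAq a₁ ha₁ h₁ (h₂.trans h₃)
        grind
  obtain ⟨x, hx, hxp, hpx⟩ := hcon p
  obtain ⟨y, hy, hyq, hqy⟩ := hcon q
  exact hqy (key x hx hxp hpx y hy hyq)

theorem dominating_of_path (hf : G.IsNoncrossing f) {R : Set V} (hR : G.IsNear R)
    {p q w : V} (hmin : ∀ x, x ≠ p → f p < f x) (hp : p ∈ R) (hq : q ∈ R) (hpq : ¬G.Adj p q)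
    (hpw : G.Adj p w) (hwq : G.Adj w q) (h₁ : f p < f w) (h₂ : f w < f q)
    {a₁ a₂ a₃ b₁ b₂ : V} (ha₁ : a₁ ∈ R) (ha₂ : a₂ ∈ R) (ha₃ : a₃ ∈ R) (hb₁ : b₁ ∈ R) (hb₂ : b₂ ∈ R)
    (h₃ : f p < f a₁) (h₄ : f a₁ < f a₂) (h₅ : f a₂ < f a₃) (h₆ : f a₃ < f q) (h₇ : f q < f b₁)
    (h₈ : f b₁ < f b₂) : ∀ x ∈ R, x ≠ w → G.Adj w x := by
  have hleft : ∀ a ∈ R, f p < f a → f a < f w → G.Adj a w := fun a ha h h' =>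
    (hf.near_across hR hpw ha hq h h' (Or.inr h₂)).elim (fun h => absurd h.2.symm hpq) And.left
  have hright : ∀ a ∈ R, f w < f a → f a < f q → G.Adj a w := fun a ha h h' =>
    (hf.near_across hR hwq ha hp h h' (Or.inl h₁)).elim And.left (fun h => absurd h.2 hpq)
  by_contra! hcon
  obtain ⟨b, hb, hbw, hwb⟩ := hcon
  have hbq : f q < f b := by
    by_contra hle
    have hbp : b ≠ p := fun h => hwb (h ▸ hpw.symm)
    have hb1 := hmin b hbp
    have hb2 : f b ≠ f q := hf.injective.ne fun h => hwb (h ▸ hwq)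
    have hb3 : f b ≠ f w := hf.injective.ne hbw
    have := hleft b hb hb1
    have := hright b hb
    have : G.Adj b w := by grind
    exact hwb this.symm
  have hleft' : ∀ a ∈ R, f p < f a → f a < f w → G.Adj a p ∧ G.Adj b p := fun a ha h h' =>
    (hf.near_across hR hpw ha hb h h' (Or.inr (h₂.trans hbq))).resolve_right
      fun h => hwb h.2.symm
  have hright' : ∀ a ∈ R, f w < f a → f a < f q → G.Adj a q ∧ G.Adj b q := fun a ha h h' =>
    (hf.near_across hR hwq ha hb h h' (Or.inr hbq)).resolve_left fun h => hwb h.2.symm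
  have h₂₁ : ¬f a₂ < f w := fun h => hf.not_both_adj h₃ h₄ h
    (hleft' a₂ ha₂ (h₃.trans h₄) h).1 (hleft a₁ ha₁ h₃ (h₄.trans h))
  have h₂₂ : ¬f w < f a₂ := fun h => hf.not_both_adj h h₅ h₆
    (hright a₃ ha₃ (h.trans h₅) h₆) (hright' a₂ ha₂ h (h₅.trans h₆)).1
  have haw : f a₁ < f w := by linarith
  have hwa : f w < f a₃ := by linarith
  have hbp := (hleft' a₁ ha₁ h₃ haw).2
  have hbq' := (hright' a₃ ha₃ hwa h₆).2
  obtain ⟨b', hb', hne, hqb'⟩ : ∃ b' ∈ R, b' ≠ b ∧ f q < f b' := by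
    by_cases h : b₁ = b
    · exact ⟨b₂, hb₂, fun h' => h₈.ne (by rw [h, h']), h₇.trans h₈⟩
    · exact ⟨b₁, hb₁, h, h₇⟩
  have hb'w : ¬G.Adj b' w := fun h => by
    rcases lt_or_gt_of_ne (hf.injective.ne hne) with hlt | hlt
    · exact hf.not_cross h₂ hqb' hlt h.symm hbq'.symm
    · exact hf.not_cross h₁ (h₂.trans hbq) hlt hbp.symm h.symm
  have hb'p : G.Adj b' p := (hf.near_across hR hpw ha₁ hb' h₃ haw
    (Or.inr (h₂.trans hqb'))).elim And.right fun h => absurd h.2 hb'w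
  have hb'q : G.Adj b' q := (hf.near_across hR hwq ha₃ hb' hwa h₆
    (Or.inr hqb')).elim (fun h => absurd h.2 hb'w) And.right
  rcases lt_or_gt_of_ne (hf.injective.ne hne) with hlt | hlt
  · exact hf.not_cross (h₁.trans h₂) hqb' hlt hb'p.symm hbq'.symm
  · exact hf.not_cross (h₁.trans h₂) hbq hlt hbp.symm hb'q.symm

/-- In a graph without crossing chords, every set of at least eight vertices with pairwise distances
at most two lies in the closed neighborhood of a vertex. -/
theorem exists_dominating [Finite V] (hf : G.IsNoncrossing f) {R : Set V} (hR : G.IsNear R)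
    (hcard : 8 ≤ R.ncard) : ∃ v, ∀ x ∈ R, x ≠ v → G.Adj v x := by
  obtain ⟨p, hp⟩ : R.Nonempty := Set.nonempty_of_ncard_ne_zero (by omega)
  obtain ⟨f, hf, hmin⟩ := hf.exists_min p
  have hcard' : 7 ≤ (R \ {p}).ncard := by
    have := Set.ncard_sdiff_singleton_add_one hp
    omega
  obtain ⟨e, he, hmono⟩ := exists_strictMono_comp_of_le_ncard hf.injective hcard' (by norm_num)
  have heR := fun i => (he i).1
  have hpe : ∀ i, f p < f (e i) := fun i => hmin _ (he i).2
  have hlt : ∀ i j, i < j → f (e i) < f (e j) := fun i j h => hmono h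
  by_cases hpq : G.Adj p (e 3)
  · exact hf.exists_dominating_of_adj hR hmin hpq (heR 0) (heR 1) (heR 4) (heR 5) (hpe 0)
      (hlt 0 1 (by decide)) (hlt 1 3 (by decide)) (hlt 3 4 (by decide)) (hlt 4 5 (by decide))
  obtain ⟨w, hpw, hqw⟩ :=
    (hR p hp (e 3) (heR 3) fun h => (hpe 3).ne (by rw [← h])).resolve_left hpq
  have h1 := hmin w hpw.ne'
  refine ⟨w, ?_⟩
  rcases lt_or_gt_of_ne (hf.injective.ne hqw.ne') with h2 | h2
  · exact hf.dominating_of_path hR hmin hp (heR 3) hpq hpw hqw.symm h1 h2 (heR 0) (heR 1)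
      (heR 2) (heR 4) (heR 5) (hpe 0) (hlt 0 1 (by decide)) (hlt 1 2 (by decide))
      (hlt 2 3 (by decide)) (hlt 3 4 (by decide)) (hlt 4 5 (by decide))
  · obtain ⟨K, hK⟩ := exists_rotate_bound f
    have hlow : ∀ {x}, f x < f (e 3) → (if f x < f (e 3) then f x + K else f x) = f x + K :=
      fun h => if_pos h
    have hhigh : ∀ {x}, f (e 3) ≤ f x → (if f x < f (e 3) then f x + K else f x) = f x :=
      fun h => if_neg h.not_gt
    have e34 := hlt 3 4 (by decide)
    have e45 := hlt 4 5 (by decide)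
    have e56 := hlt 5 6 (by decide)
    have e01 := hlt 0 1 (by decide)
    have e13 := hlt 1 3 (by decide)
    have e0 := hpe 0
    have k6 := hK (e 6) p
    have kw := hK w p
    refine (hf.rotate hK (f (e 3))).dominating_of_path hR (q := p) (fun x hx => ?_) (heR 3) hp
      (fun h => hpq h.symm) hqw hpw.symm ?_ ?_ (heR 4) (heR 5) (heR 6) (heR 0) (heR 1)
      ?_ ?_ ?_ ?_ ?_ ?_
    · have := hf.injective.ne hx
      have := hK (e 3) x
      split_ifs <;> grind
    all_goals
      first
        | rw [hhigh (by linarith), hhigh (by linarith)]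
        | rw [hlow (by linarith), hlow (by linarith)]
        | rw [hhigh (by linarith), hlow (by linarith)]
      linarith

/-- Two neighbors of `v` with two further neighbors of `v` between them are not adjacent, and `v` is
their only common neighbor. -/
theorem eq_of_common_neighbor (hf : G.IsNoncrossing f) {v x₁ x₂ x₃ x₄ : V}
    (hmin : ∀ x, x ≠ v → f v < f x) (h₁ : G.Adj v x₁) (h₂ : G.Adj v x₂) (h₃ : G.Adj v x₃)
    (h₁₂ : f x₁ < f x₂) (h₂₃ : f x₂ < f x₃) (h₃₄ : f x₃ < f x₄) :
    ¬G.Adj x₁ x₄ ∧ ∀ w, G.Adj x₁ w → G.Adj x₄ w → w = v := by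
  have hv := hmin x₁ h₁.ne'
  refine ⟨fun h => hf.not_cross hv h₁₂ (h₂₃.trans h₃₄) h₂ h, fun w hw1 hw4 => ?_⟩
  by_contra hwv
  have hw := hmin w hwv
  rcases lt_trichotomy (f w) (f x₂) with h | h | h
  · exact hf.not_cross hw h (h₂₃.trans h₃₄) h₂ hw4.symm
  · obtain rfl := hf.injective h
    exact hf.not_cross hw h₂₃ h₃₄ h₃ hw4.symm
  · exact hf.not_cross hv h₁₂ h h₂ hw1

end IsNoncrossing

end SimpleGraph

/-- The ways in which a vertex can be joined to another one: by an outgoing arc, by an incoming arc,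
or by an edge, of a given color. -/
abbrev Joint (m n : ℕ) := Fin m ⊕ Fin m ⊕ Fin n

namespace Joint

variable {m n : ℕ}

/-- The same connection seen from the other end. -/
def opp : Joint m n → Joint m n
  | .inl c => .inr (.inl c)
  | .inr (.inl c) => .inl c
  | .inr (.inr c) => .inr (.inr c)

@[simp] theorem opp_opp : ∀ t : Joint m n, t.opp.opp = t
  | .inl _ => rfl
  | .inr (.inl _) => rfl
  | .inr (.inr _) => rfl

theorem opp_injective : Function.Injective (opp : Joint m n → Joint m n) :=
  Function.LeftInverse.injective opp_opp

theorem card : Nat.card (Joint m n) = 2 * m + n := by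
  simp [two_mul, add_assoc]

end Joint

namespace ColoredMixedGraph

variable {m n : ℕ} {V W X : Type*}

/-- `G.joint t x y`: the vertex `x` is joined to `y` in the way `t`. -/
def joint (G : ColoredMixedGraph m n V) : Joint m n → V → V → Prop
  | .inl c, x, y => G.arc c x y
  | .inr (.inl c), x, y => G.arc c y x
  | .inr (.inr c), x, y => G.edge c x y

section joint

variable {G : ColoredMixedGraph m n V}

theorem joint.symm : ∀ {t : Joint m n} {x y : V}, G.joint t x y → G.joint t.opp y x
  | .inl _, _, _, h => h
  | .inr (.inl _), _, _, h => h
  | .inr (.inr _), _, _, h => G.edge_symm _ _ _ h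

theorem underlying_adj_iff {x y : V} : G.underlying.Adj x y ↔ ∃ t, G.joint t x y := by
  constructor
  · rintro (⟨c, h | h⟩ | ⟨c, h⟩)
    · exact ⟨.inl c, h⟩
    · exact ⟨.inr (.inl c), h⟩
    · exact ⟨.inr (.inr c), h⟩
  · rintro ⟨c | c | c, h⟩
    · exact Or.inl ⟨c, Or.inl h⟩
    · exact Or.inl ⟨c, Or.inr h⟩
    · exact Or.inr ⟨c, h⟩

theorem joint.adj {t : Joint m n} {x y : V} (h : G.joint t x y) : G.underlying.Adj x y :=
  underlying_adj_iff.2 ⟨t, h⟩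

theorem joint.ne {t : Joint m n} {x y : V} (h : G.joint t x y) : x ≠ y := h.adj.ne

theorem joint.unique : ∀ {t s : Joint m n} {x y : V}, G.joint t x y → G.joint s x y → t = s
  | .inl _, .inl _, _, _, h, h' => congrArg _ (G.arc_color_unique _ _ _ _ h h')
  | .inl _, .inr (.inl _), _, _, h, h' => absurd h' (G.arc_asymm _ _ _ _ h)
  | .inl _, .inr (.inr _), _, _, h, h' => absurd h' (G.not_arc_and_edge _ _ _ _ h)
  | .inr (.inl _), .inl _, _, _, h, h' => absurd h (G.arc_asymm _ _ _ _ h')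
  | .inr (.inl _), .inr (.inl _), _, _, h, h' =>
    congrArg (Sum.inr ∘ Sum.inl) (G.arc_color_unique _ _ _ _ h h')
  | .inr (.inl _), .inr (.inr _), _, _, h, h' =>
    absurd (G.edge_symm _ _ _ h') (G.not_arc_and_edge _ _ _ _ h)
  | .inr (.inr _), .inl _, _, _, h, h' => absurd h (G.not_arc_and_edge _ _ _ _ h')
  | .inr (.inr _), .inr (.inl _), _, _, h, h' =>
    absurd (G.edge_symm _ _ _ h) (G.not_arc_and_edge _ _ _ _ h')
  | .inr (.inr _), .inr (.inr _), _, _, h, h' =>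
    congrArg (Sum.inr ∘ Sum.inr) (G.edge_color_unique _ _ _ _ h h')

end joint

theorem isHom_iff {G : ColoredMixedGraph m n V} {H : ColoredMixedGraph m n W} {f : V → W} :
    G.IsHom H f ↔ ∀ t x y, G.joint t x y → H.joint t (f x) (f y) := by
  constructor
  · rintro ⟨h1, h2⟩ (c | c | c) x y h
    · exact h1 c x y h
    · exact h1 c y x h
    · exact h2 c x y h
  · exact fun h => ⟨fun c => h (.inl c), fun c => h (.inr (.inr c))⟩

theorem IsHom.comp {G : ColoredMixedGraph m n V} {H : ColoredMixedGraph m n W}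
    {K : ColoredMixedGraph m n X} {g : W → X} {f : V → W} (hg : H.IsHom K g) (hf : G.IsHom H f) :
    G.IsHom K (g ∘ f) :=
  ⟨fun c x y h => hg.1 c _ _ (hf.1 c x y h), fun c x y h => hg.2 c _ _ (hf.2 c x y h)⟩

/-- The colored mixed graph whose vertices are joined as a given relation says. -/
def ofJoint (r : Joint m n → V → V → Prop) (symm : ∀ t x y, r t x y → r t.opp y x)
    (irrefl : ∀ t x, ¬r t x x) (unique : ∀ t s x y, r t x y → r s x y → t = s) :
    ColoredMixedGraph m n V where
  arc c x y := r (.inl c) x y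
  edge c x y := r (.inr (.inr c)) x y
  edge_symm c x y h := symm _ _ _ h
  edge_irrefl c x := irrefl _ x
  arc_asymm c d x y h h' := by simpa [Joint.opp] using unique _ _ _ _ h (symm _ _ _ h')
  arc_color_unique c d x y h h' := by simpa using unique _ _ _ _ h h'
  edge_color_unique c d x y h h' := by simpa using unique _ _ _ _ h h'
  not_arc_and_edge c d x y h h' := by simpa using unique _ _ _ _ h h'

theorem joint_ofJoint {r : Joint m n → V → V → Prop} (symm : ∀ t x y, r t x y → r t.opp y x)
    (irrefl : ∀ t x, ¬r t x x) (unique : ∀ t s x y, r t x y → r s x y → t = s) :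
    ∀ {t : Joint m n} {x y}, (ofJoint r symm irrefl unique).joint t x y ↔ r t x y
  | .inl _, _, _ => Iff.rfl
  | .inr (.inl _), _, _ => ⟨fun h => symm _ _ _ h, fun h => symm _ _ _ h⟩
  | .inr (.inr _), _, _ => Iff.rfl

/-- The pullback of a colored mixed graph along a map. -/
def comap (G : ColoredMixedGraph m n W) (f : V → W) : ColoredMixedGraph m n V where
  arc c x y := G.arc c (f x) (f y)
  edge c x y := G.edge c (f x) (f y)
  edge_symm c _ _ := G.edge_symm c _ _
  edge_irrefl c _ := G.edge_irrefl c _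
  arc_asymm c d _ _ := G.arc_asymm c d _ _
  arc_color_unique c d _ _ := G.arc_color_unique c d _ _
  edge_color_unique c d _ _ := G.edge_color_unique c d _ _
  not_arc_and_edge c d _ _ := G.not_arc_and_edge c d _ _

theorem isHom_comap (G : ColoredMixedGraph m n W) (f : V → W) : (G.comap f).IsHom G f :=
  ⟨fun _ _ _ h => h, fun _ _ _ h => h⟩

/-- The image of `G` under the identification of two vertices that are not adjacent and are not
distinguished by a common neighbor. -/
theorem exists_isHom_identify {G : ColoredMixedGraph m n V} {x y : V}
    (hadj : ¬G.underlying.Adj x y)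
    (hspecial : ∀ w t s, G.joint t w x → G.joint s w y → t = s) :
    ∃ (H : ColoredMixedGraph m n V) (f : V → V), G.IsHom H f ∧ f x = f y := by
  classical
  let f : V → V := fun z => if z = y then x else z
  have hf : ∀ {a b}, f a = f b → a = b ∨ (a = x ∧ b = y) ∨ (a = y ∧ b = x) := fun {a b} h => by
    simp only [f] at h
    split_ifs at h <;> grind
  have hxy : ∀ t, ¬G.joint t x y := fun t h => hadj h.adj
  have hyx : ∀ t, ¬G.joint t y x := fun t h => hadj h.adj.symm
  have hxx : ∀ t a, ¬G.joint t a a := fun t a h => h.ne rfl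
  have hright : ∀ {t s w a b}, G.joint t w a → G.joint s w b → f a = f b → t = s := by
    rintro t s w a b h h' hab
    rcases hf hab with rfl | ⟨rfl, rfl⟩ | ⟨rfl, rfl⟩
    · exact h.unique h'
    · exact hspecial _ _ _ h h'
    · exact (hspecial _ _ _ h' h).symm
  let H : ColoredMixedGraph m n V :=
    ofJoint (fun t a b => ∃ a' b', f a' = a ∧ f b' = b ∧ G.joint t a' b')
      (by rintro t _ _ ⟨a, b, rfl, rfl, h⟩; exact ⟨b, a, rfl, rfl, h.symm⟩)
      (by
        rintro t c ⟨a, b, rfl, hab, h⟩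
        rcases hf hab with rfl | ⟨rfl, rfl⟩ | ⟨rfl, rfl⟩
        · exact hxx _ _ h
        · exact hyx _ h
        · exact hxy _ h)
      (by
        rintro t s _ _ ⟨a, b, rfl, rfl, h⟩ ⟨a', b', ha, hb, h'⟩
        rcases hf hb with rfl | hb'
        · exact Joint.opp_injective (hright h.symm h'.symm ha.symm)
        rcases hf ha with rfl | ha'
        · exact hright h h' hb.symm
        · grind)
  refine ⟨H, f, isHom_iff.2 fun t a b h => (joint_ofJoint ..).2 ⟨a, b, rfl, rfl, h⟩, ?_⟩
  simp [f]

theorem IsRelClique.adj_or_exists_joint {V : Type u} [Finite V] {G : ColoredMixedGraph m n V}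
    {R : Set V} (hR : G.IsRelClique R) {x y : V} (hx : x ∈ R) (hy : y ∈ R) (hxy : x ≠ y) :
    G.underlying.Adj x y ∨ ∃ w t s, t ≠ s ∧ G.joint t w x ∧ G.joint s w y := by
  by_contra! hcon
  obtain ⟨H, f, hf, he⟩ := exists_isHom_identify hcon.1
    fun w t s h h' => by_contra fun hts => hcon.2 w t s hts h h'
  exact hR x hx y hy hxy V H f hf he

theorem IsHom.ne_of_adj {G : ColoredMixedGraph m n V} {H : ColoredMixedGraph m n W} {f : V → W}
    (hf : G.IsHom H f) {x y : V} (h : G.underlying.Adj x y) : f x ≠ f y := by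
  obtain ⟨t, ht⟩ := underlying_adj_iff.1 h
  exact (isHom_iff.1 hf t x y ht).ne

theorem IsHom.ne_of_joint {G : ColoredMixedGraph m n V} {H : ColoredMixedGraph m n W} {f : V → W}
    (hf : G.IsHom H f) {x y w : V} {t s : Joint m n} (hts : t ≠ s) (hx : G.joint t w x)
    (hy : G.joint s w y) : f x ≠ f y := fun h =>
  hts ((isHom_iff.1 hf t w x hx).unique (h ▸ isHom_iff.1 hf s w y hy))

theorem chromaticNumber_le {G : ColoredMixedGraph m n V} [Finite W] {H : ColoredMixedGraph m n W}
    {f : V → W} (hf : G.IsHom H f) : G.chromaticNumber ≤ Nat.card W := by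
  let e := Finite.equivFin W
  refine Nat.sInf_le ⟨H.comap e.symm, e ∘ f, ?_⟩
  exact ⟨fun c x y h => by simpa [comap] using hf.1 c x y h,
    fun c x y h => by simpa [comap] using hf.2 c x y h⟩

theorem isHom_id (G : ColoredMixedGraph m n V) : G.IsHom G id :=
  ⟨fun _ _ _ h => h, fun _ _ _ h => h⟩

theorem exists_isHom_fin_chromaticNumber [Finite V] (G : ColoredMixedGraph m n V) :
    ∃ (H : ColoredMixedGraph m n (Fin G.chromaticNumber)) (f : V → Fin G.chromaticNumber),
      G.IsHom H f := by
  let e := Finite.equivFin V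
  exact Nat.sInf_mem (s := {k | ∃ (H : ColoredMixedGraph m n (Fin k)) (f : V → Fin k), G.IsHom H f})
    ⟨Nat.card V, G.comap e.symm, e, fun c x y h => by simpa [comap] using h,
      fun c x y h => by simpa [comap] using h⟩

theorem IsClique.injective_of_isHom [Finite V] {G : ColoredMixedGraph m n V} (hG : G.IsClique)
    {H : ColoredMixedGraph m n W} {f : V → W} (hf : G.IsHom H f) : Function.Injective f := by
  have hle : Nat.card V ≤ Nat.card (Set.range f) := hG ▸ chromaticNumber_le
    (H := H.comap Subtype.val) (f := Set.rangeFactorization f) hf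
  have hb := Set.rangeFactorization_surjective.bijective_of_nat_card_le
    (f := Set.rangeFactorization f) hle
  exact Set.rangeFactorization_injective.1 hb.injective

theorem isClique_of_injective [Finite V] {G : ColoredMixedGraph m n V}
    (h : ∀ (k : ℕ) (H : ColoredMixedGraph m n (Fin k)) (f : V → Fin k),
      G.IsHom H f → Function.Injective f) : G.IsClique := by
  refine le_antisymm (chromaticNumber_le G.isHom_id) ?_
  obtain ⟨H, f, hf⟩ := G.exists_isHom_fin_chromaticNumber
  simpa using Nat.card_le_card_of_injective f (h _ H f hf)

theorem absCliqueNumber_le_relCliqueNumber {V : Type u} [Finite V] (G : ColoredMixedGraph m n V) :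
    G.absCliqueNumber ≤ G.relCliqueNumber := by
  refine iSup_le fun S => iSup_le fun H => iSup_le fun hsub => iSup_le fun hH => ?_
  refine le_iSup₂_of_le S (fun x hx y hy hxy W _ K g hg heq => hxy ?_) le_rfl
  exact congrArg Subtype.val (@IsClique.injective_of_isHom _ _ _ _ _ _ hH K _ (hg.comp hsub)
    ⟨x, hx⟩ ⟨y, hy⟩ heq)

theorem card_le_absCliqueNumber [Finite V] {G : ColoredMixedGraph m n V}
    (h : ∀ (k : ℕ) (H : ColoredMixedGraph m n (Fin k)) (f : V → Fin k),
      G.IsHom H f → Function.Injective f) : (Nat.card V : ℕ∞) ≤ G.absCliqueNumber := by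
  refine le_iSup_of_le Set.univ (le_iSup_of_le (G.comap Subtype.val) (le_iSup_of_le
    (G.isHom_comap _) (le_iSup_of_le (isClique_of_injective fun k H f hf => ?_) ?_)))
  · have := h k H (fun x => f ⟨x, trivial⟩)
      ⟨fun c x y => hf.1 c ⟨x, trivial⟩ ⟨y, trivial⟩, fun c x y => hf.2 c ⟨x, trivial⟩ ⟨y, trivial⟩⟩
    exact fun x y hxy => Subtype.ext (this hxy)
  · rw [Set.encard_univ, ENat.card_eq_coe_natCard]

end ColoredMixedGraph

namespace ColoredMixedGraph

variable {m n : ℕ}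

theorem IsRelClique.isNear {V : Type u} [Finite V] {G : ColoredMixedGraph m n V} {R : Set V}
    (hR : G.IsRelClique R) : G.underlying.IsNear R := fun _ hx _ hy hxy =>
  (hR.adj_or_exists_joint hx hy hxy).imp_right fun ⟨w, _, _, _, h, h'⟩ =>
    ⟨w, h.adj.symm, h'.adj.symm⟩

/-- In a graph without crossing chords, a relative clique contains at most three vertices that are
joined in a given way to a given vertex. -/
theorem IsRelClique.ncard_joint_le_three {V : Type u} [Finite V] {G : ColoredMixedGraph m n V}
    {f : V → ℝ} (hf : G.underlying.IsNoncrossing f) {R : Set V} (hR : G.IsRelClique R) (v : V)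
    (t : Joint m n) : {x ∈ R | G.joint t v x}.ncard ≤ 3 := by
  by_contra! hcard
  obtain ⟨f, hf, hmin⟩ := hf.exists_min v
  obtain ⟨e, he, hmono⟩ := exists_strictMono_comp_of_le_ncard hf.injective
    (Nat.succ_le_of_lt hcard) (by norm_num)
  have hlt : ∀ i j, i < j → f (e i) < f (e j) := fun i j h => hmono h
  obtain ⟨hnadj, hcommon⟩ := hf.eq_of_common_neighbor hmin (he 0).2.adj (he 1).2.adj (he 2).2.adj
    (hlt 0 1 (by decide)) (hlt 1 2 (by decide)) (hlt 2 3 (by decide))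
  obtain ⟨w, s, s', hs, h, h'⟩ := (hR.adj_or_exists_joint (he 0).1 (he 3).1
    fun h => (hlt 0 3 (by decide)).ne (by rw [h])).resolve_left hnadj
  obtain rfl := hcommon w h.adj.symm h'.adj.symm
  exact hs ((h.unique (he 0).2).trans ((he 3).2.unique h'))

theorem IsRelClique.ncard_le {V : Type u} [Finite V] {G : ColoredMixedGraph m n V}
    {f : V → ℝ} (hf : G.underlying.IsNoncrossing f) {R : Set V} (hR : G.IsRelClique R)
    (hmn : 2 * m + n ≠ 1) : R.ncard ≤ 3 * (2 * m + n) + 1 := by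
  rcases Nat.eq_zero_or_pos (2 * m + n) with h0 | hpos
  · have hempty : IsEmpty (Joint m n) :=
      (Nat.card_eq_zero.1 (Joint.card.trans h0)).resolve_right fun h => h.not_finite inferInstance
    rw [h0, mul_zero, zero_add, Set.ncard_le_one]
    refine fun x hx y hy => by_contra fun hxy => ?_
    rcases hR.adj_or_exists_joint hx hy hxy with h | ⟨-, t, -⟩
    · exact hempty.false (underlying_adj_iff.1 h).choose
    · exact hempty.false t
  by_contra! hcard
  obtain ⟨v, hv⟩ := hf.exists_dominating hR.isNear (by omega)
  have hsub : R ⊆ insert v (⋃ t ∈ Finset.univ, {x ∈ R | G.joint t v x}) := fun x hx => by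
    by_cases hxv : x = v
    · exact Or.inl hxv
    · obtain ⟨t, ht⟩ := underlying_adj_iff.1 (hv x hx hxv)
      exact Or.inr (Set.mem_biUnion (Finset.mem_univ t) ⟨hx, ht⟩)
  have h1 := (Set.ncard_le_ncard hsub).trans (Set.ncard_insert_le _ _)
  have h2 : (⋃ t ∈ Finset.univ, {x ∈ R | G.joint t v x}).ncard ≤ ∑ _t : Joint m n, 3 :=
    (Finset.set_ncard_biUnion_le _ _).trans (Finset.sum_le_sum fun t _ => hR.ncard_joint_le_three hf v t)
  rw [Finset.sum_const, Finset.card_univ, ← Nat.card_eq_fintype_card, Joint.card,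
    smul_eq_mul] at h2
  omega

end ColoredMixedGraph

/-- The relation of being joined in a given way in the following fan: the vertex `none` is joined in
every way `t` to the three vertices `(t, 0)`, `(t, 1)`, `(t, 2)`, and these form a path whose middle
vertex is joined in the way `a t` to the first and in the way `t` to the last one. -/
inductive FanJoint {m n : ℕ} (a : Joint m n → Joint m n) :
    Joint m n → Option (Joint m n × Fin 3) → Option (Joint m n × Fin 3) → Prop
  | spoke (t : Joint m n) (k : Fin 3) : FanJoint a t none (some (t, k))
  | spoke_opp (t : Joint m n) (k : Fin 3) : FanJoint a t.opp (some (t, k)) none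
  | first (t : Joint m n) : FanJoint a (a t) (some (t, 1)) (some (t, 0))
  | first_opp (t : Joint m n) : FanJoint a (a t).opp (some (t, 0)) (some (t, 1))
  | last (t : Joint m n) : FanJoint a t (some (t, 1)) (some (t, 2))
  | last_opp (t : Joint m n) : FanJoint a t.opp (some (t, 2)) (some (t, 1))

namespace FanJoint

variable {m n : ℕ} {a : Joint m n → Joint m n}

theorem symm {t : Joint m n} {x y} (h : FanJoint a t x y) : FanJoint a t.opp y x := by
  cases h <;> (try rw [Joint.opp_opp]) <;> constructor

theorem irrefl {t : Joint m n} {x} : ¬FanJoint a t x x := by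
  intro h
  generalize hy : x = y at h
  nth_rw 1 [← hy] at h
  cases h <;> simp at hy

theorem unique {t s : Joint m n} {x y} (h : FanJoint a t x y) (h' : FanJoint a s x y) : t = s := by
  cases h <;> cases h' <;> rfl

/-- The fan as a colored mixed graph. -/
def graph (a : Joint m n → Joint m n) : ColoredMixedGraph m n (Option (Joint m n × Fin 3)) :=
  .ofJoint (FanJoint a) (fun _ _ _ => symm) (fun _ _ => irrefl) (fun _ _ _ _ => unique)

theorem joint_graph {t : Joint m n} {x y} : (graph a).joint t x y ↔ FanJoint a t x y :=
  ColoredMixedGraph.joint_ofJoint ..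

theorem injective_of_isHom (ha : ∀ t, a t ≠ t) {W : Type*} {H : ColoredMixedGraph m n W}
    {f : Option (Joint m n × Fin 3) → W} (hf : (graph a).IsHom H f) : Function.Injective f := by
  have hadj : ∀ {t x y}, FanJoint a t x y → f x ≠ f y := fun h =>
    hf.ne_of_adj (joint_graph.2 h).adj
  have hjoint : ∀ {t s w x y}, FanJoint a t w x → FanJoint a s w y → t ≠ s → f x ≠ f y :=
    fun h h' hts => hf.ne_of_joint hts (joint_graph.2 h) (joint_graph.2 h')
  rintro (_ | ⟨t, k⟩) (_ | ⟨s, l⟩) h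
  · rfl
  · exact absurd h (hadj (.spoke s l))
  · exact absurd h (hadj (.spoke_opp t k))
  · by_cases hts : t = s
    · subst hts
      have h01 := hadj (FanJoint.first (a := a) t)
      have h12 := hadj (FanJoint.last (a := a) t)
      have h02 := hjoint (FanJoint.first (a := a) t) (.last t) (ha t)
      fin_cases k <;> fin_cases l <;> first | rfl | exact absurd h ‹_› | exact absurd h.symm ‹_›
    · exact absurd h (hjoint (.spoke t k) (.spoke s l) hts)

/-- The position of the vertices of the fan in a linear order. -/
noncomputable def position : Option (Joint m n × Fin 3) → ℕ
  | none => 0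
  | some (t, k) => 3 * (Finite.equivFin (Joint m n) t : ℕ) + k + 1

theorem position_injective :
    Function.Injective (position : Option (Joint m n × Fin 3) → ℕ) := by
  rintro (_ | ⟨t, k⟩) (_ | ⟨s, l⟩) h
  · rfl
  · simp [position] at h
  · simp [position] at h
  · simp only [position] at h
    have h1 : Finite.equivFin (Joint m n) t = Finite.equivFin (Joint m n) s := Fin.ext (by omega)
    obtain rfl := (Finite.equivFin _).injective h1
    have : k = l := Fin.ext (by omega)
    rw [this]

theorem position_le {t : Joint m n} {x y} (h : FanJoint a t x y) (h0 : 0 < position x) :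
    position y ≤ position x + 1 := by
  cases h <;> simp [position] at h0 ⊢

theorem isNoncrossing_graph :
    (graph a).underlying.IsNoncrossing fun x => (position x : ℝ) := by
  refine ⟨Nat.cast_injective.comp position_injective, fun {x y z w} hxy hyz hzw _ h => ?_⟩
  obtain ⟨t, ht⟩ := ColoredMixedGraph.underlying_adj_iff.1 h
  have := position_le (joint_graph.1 ht)
  rw [Nat.cast_lt] at hxy hyz hzw
  omega

theorem card_vertices :
    Nat.card (Option (Joint m n × Fin 3)) = 3 * (2 * m + n) + 1 := by
  rw [Finite.card_option, Nat.card_prod, Joint.card, Nat.card_fin, mul_comm]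

end FanJoint

theorem exists_forall_ne_self {m n : ℕ} (hmn : 2 * m + n ≠ 1) :
    ∃ a : Joint m n → Joint m n, ∀ t, a t ≠ t := by
  have : ∀ t : Joint m n, ∃ s, s ≠ t := fun t => by
    by_contra! h
    have : Unique (Joint m n) := ⟨⟨t⟩, h⟩
    exact hmn (Joint.card.symm.trans Nat.card_unique)
  choose a ha using this
  exact ⟨a, ha⟩

theorem SimpleGraph.IsNoncrossing.comap_injective {V W : Type*} {G : SimpleGraph W} {f : W → ℝ}
    (hf : G.IsNoncrossing f) {H : SimpleGraph V} {e : V → W} (he : Function.Injective e)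
    (h : ∀ x y, H.Adj x y → G.Adj (e x) (e y)) : H.IsNoncrossing fun x => f (e x) :=
  ⟨hf.injective.comp he, fun hab hbc hcd hac hbd => hf.not_cross hab hbc hcd (h _ _ hac) (h _ _ hbd)⟩

theorem le_familyAbsCliqueNumber_isOuterplanar {m n : ℕ} (hmn : 2 * m + n ≠ 1) :
    ((3 * (2 * m + n) + 1 : ℕ) : ℕ∞) ≤ familyAbsCliqueNumber.{u} m n IsOuterplanar := by
  obtain ⟨a, ha⟩ := exists_forall_ne_self hmn
  let e : ULift.{u} (Option (Joint m n × Fin 3)) ≃ Option (Joint m n × Fin 3) := Equiv.ulift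
  let G := (FanJoint.graph a).comap e
  have hG : IsOuterplanar G.underlying :=
    ((FanJoint.isNoncrossing_graph (a := a)).comap_injective e.injective
      fun _ _ h => h).isOuterplanar
  refine le_iSup₂_of_le (ULift (Option (Joint m n × Fin 3))) inferInstance
    (le_iSup₂_of_le G.underlying hG (le_iSup₂_of_le G rfl ?_))
  rw [← FanJoint.card_vertices (m := m) (n := n), ← Nat.card_congr e]
  refine ColoredMixedGraph.card_le_absCliqueNumber fun k H f hf => ?_
  have : Function.Injective (f ∘ e.symm) := FanJoint.injective_of_isHom ha
    ⟨fun c x y h => hf.1 c (e.symm x) (e.symm y) h, fun c x y h => hf.2 c (e.symm x) (e.symm y) h⟩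
  simpa using this.comp e.injective

theorem familyAbsCliqueNumber_le_familyRelCliqueNumber (m n : ℕ)
    (F : ∀ {V : Type u}, SimpleGraph V → Prop) :
    familyAbsCliqueNumber.{u} m n F ≤ familyRelCliqueNumber.{u} m n F :=
  iSup₂_mono fun _ _ => iSup₂_mono fun _ _ => iSup₂_mono fun C _ =>
    C.absCliqueNumber_le_relCliqueNumber

theorem familyRelCliqueNumber_isOuterplanar_le {m n : ℕ} (hmn : 2 * m + n ≠ 1) :
    familyRelCliqueNumber.{u} m n IsOuterplanar ≤ ((3 * (2 * m + n) + 1 : ℕ) : ℕ∞) := by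
  refine iSup₂_le fun V _ => iSup₂_le fun G hG => iSup₂_le fun C hC => iSup₂_le fun R hR => ?_
  obtain ⟨D⟩ := hG
  subst hC
  rw [← R.toFinite.cast_ncard_eq]
  exact_mod_cast hR.ncard_le D.isNoncrossing hmn

theorem mainTheorem1 (m n : ℕ) (hmn : (m, n) ≠ (0, 1)) :
    familyAbsCliqueNumber.{u} m n IsOuterplanar = ((3 * (2 * m + n) + 1 : ℕ) : ℕ∞) ∧
      familyRelCliqueNumber.{u} m n IsOuterplanar = ((3 * (2 * m + n) + 1 : ℕ) : ℕ∞) := by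
  have h : 2 * m + n ≠ 1 := fun h => hmn (by rw [Prod.mk.injEq]; omega)
  have h₁ := le_familyAbsCliqueNumber_isOuterplanar.{u} h
  have h₂ := familyRelCliqueNumber_isOuterplanar_le.{u} h
  have h₃ := familyAbsCliqueNumber_le_familyRelCliqueNumber.{u} m n IsOuterplanar
  exact ⟨(h₃.trans h₂).antisymm h₁, h₂.antisymm (h₁.trans h₃)⟩
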